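/- For measurable functions $f,g:\mathbb{R}\to\mathbb{C}$ and $x\in\mathbb{R}$ put $$T(f,g)(x)=\int_{1/4<|t|<1}|f(x-t)\,g(x-t^2)|\,dt\in[0,\infty].$$ Let $1<p,q\le\infty$ and let $r$ be defined by $\frac1r=\frac1p+\frac1q$ (with $\frac1\infty=0$; thus $\frac12<r\le\infty$, and values $r<1$ are allowed). Then $T$ is bounded from $L^p(\mathbb{R})\times L^q(\mathbb{R})$ to $L^r(\mathbb{R})$: there is a finite constant $C$, depending only on $p$ and $q$, such that for all $f\in L^p(\mathbb{R})$ and $g\in L^q(\mathbb{R})$ the function $T(f,g)$ belongs to $L^r(\mathbb{R})$ (in particular it is finite almost everywhere) and $$\|T(f,g)\|_{L^r(\mathbb{R})}\le C\,\|f\|_{L^p(\mathbb{R})}\,\|g\|_{L^q(\mathbb{R})}.$$ -/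

import Mathlib

open MeasureTheory
open scoped ENNReal NNReal

/-- The operator `T(f,g)(x) = ∫_{1/4 < |t| < 1} |f(x - t) g(x - t ^ 2)| dt`. The integrand is
nonnegative, so the integral is the Lebesgue integral with values in `[0, ∞]`. -/
noncomputable def parabolaT (f g : ℝ → ℂ) (x : ℝ) : ℝ≥0∞ :=
  ∫⁻ t in {t : ℝ | 1 / 4 < |t| ∧ |t| < 1}, ‖f (x - t) * g (x - t ^ 2)‖ₑ

/-! After the translation u = x - t, the L¹ × L¹ → L¹ bound reduces to the change of variables t ↦ u
+ t - t², whose Jacobian 1 - 2t vanishes only at t = 1/2. On the dyadic shell |t - 1/2| ~ δ this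
gives the constant 2/δ, which blows up as δ → 0. But the shell moves both t and t² by only O(δ), so
the operator is local at scale δ. Applying Hölder on windows of length O(δ) and averaging over their
position turns the L¹ bound into L¹ × L^Q → L^R with 1/R = 1 + 1/Q, and there all powers of δ cancel
(`lintegral_curveOp_rpow_le`).

A bound uniform in δ cannot be summed over shells. A weight |t - 1/2|^α with α > 0 supplies
geometric decay (`ShellBounds.exists_weighted_bound`). The hypothesis p > 1 pays for the weight:
Hölder in t passes to F^p, G^p and leaves the integrable factor |t - 1/2|^(-1/2)
(`curveOp_rpow_le_weighted`). This settles p ≤ q < ∞. At q = ∞ the function G is replaced by its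
essential supremum, and q ≤ p follows by exchanging the two functions. -/

/-- The bilinear form `x ↦ ∫_A F(x - a t) G(x - b t) dt` along the curve `t ↦ (a t, b t)`. -/
noncomputable def curveOp (a b : ℝ → ℝ) (A : Set ℝ) (F G : ℝ → ℝ≥0∞) (x : ℝ) : ℝ≥0∞ :=
  ∫⁻ t in A, F (x - a t) * G (x - b t)

theorem curveOp_swap (a b : ℝ → ℝ) (A : Set ℝ) (F G : ℝ → ℝ≥0∞) :
    curveOp b a A G F = curveOp a b A F G := by
  funext x
  simp only [curveOp, mul_comm]

theorem measurable_curveOp {a b : ℝ → ℝ} (ha : Measurable a) (hb : Measurable b) (A : Set ℝ)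
    {F G : ℝ → ℝ≥0∞} (hF : Measurable F) (hG : Measurable G) :
    Measurable (curveOp a b A F G) := by
  have h : Measurable fun z : ℝ × ℝ => F (z.1 - a z.2) * G (z.1 - b z.2) := by fun_prop
  exact h.lintegral_prod_right'

/-! ### Averages over sliding windows and power inequalities. -/

/-- By Tonelli: a fixed x lies in the window exactly for y in an interval of length l. -/
theorem lintegral_window {H : ℝ → ℝ≥0∞} (hH : Measurable H) (c l : ℝ) :
    ∫⁻ y, ∫⁻ x in Set.Icc (y + c) (y + c + l), H x = ENNReal.ofReal l * ∫⁻ x, H x := by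
  have hS : MeasurableSet {z : ℝ × ℝ | z.1 + c ≤ z.2 ∧ z.2 ≤ z.1 + c + l} :=
    by
    measurability
  have e1 (y x : ℝ) : (Set.Icc (y + c) (y + c + l)).indicator H x =
      (Set.Icc (x - c - l) (x - c)).indicator (fun _ => H x) y := by
    simp only [Set.indicator_apply, Set.mem_Icc]
    congr 1
    apply propext
    constructor <;> rintro ⟨h1, h2⟩ <;> constructor <;> linarith
  have e2 : (Function.uncurry fun y x : ℝ => (Set.Icc (y + c) (y + c + l)).indicator H x) =
      {z : ℝ × ℝ | z.1 + c ≤ z.2 ∧ z.2 ≤ z.1 + c + l}.indicator (fun z => H z.2) := by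
    funext z
    simp [Function.uncurry, Set.indicator_apply]
  calc ∫⁻ y, ∫⁻ x in Set.Icc (y + c) (y + c + l), H x
      = ∫⁻ y, ∫⁻ x, (Set.Icc (y + c) (y + c + l)).indicator H x := by
        simp_rw [lintegral_indicator measurableSet_Icc]
    _ = ∫⁻ x, ∫⁻ y, (Set.Icc (y + c) (y + c + l)).indicator H x := by
        apply lintegral_lintegral_swap
        rw [e2]
        exact ((hH.comp measurable_snd).indicator hS).aemeasurable
    _ = ∫⁻ x, ENNReal.ofReal l * H x := by
        simp_rw [e1, lintegral_indicator measurableSet_Icc]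
        refine lintegral_congr fun x => ?_
        rw [lintegral_const, Measure.restrict_apply MeasurableSet.univ, Set.univ_inter,
          Real.volume_Icc, mul_comm]
        congr 2
        ring
    _ = _ := lintegral_const_mul _ hH

theorem measurable_lintegral_window {H : ℝ → ℝ≥0∞} (hH : Measurable H) (c l : ℝ) :
    Measurable fun y => ∫⁻ x in Set.Icc (y + c) (y + c + l), H x := by
  have hS : MeasurableSet {z : ℝ × ℝ | z.1 + c ≤ z.2 ∧ z.2 ≤ z.1 + c + l} :=
    by
    measurability
  have h := ((hH.comp measurable_snd).indicator hS).lintegral_prod_right' (ν := volume)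
  convert h using 2 with y
  rw [← lintegral_indicator measurableSet_Icc]
  simp [Set.indicator_apply]

theorem lintegral_rpow_le_mul_measure {α : Type*} [MeasurableSpace α] (μ : Measure α)
    {H : α → ℝ≥0∞} (hH : AEMeasurable H μ) {θ : ℝ} (h0 : 0 ≤ θ) (h1 : θ ≤ 1) :
    ∫⁻ x, H x ^ θ ∂μ ≤ (∫⁻ x, H x ∂μ) ^ θ * μ Set.univ ^ (1 - θ) := by
  have h := ENNReal.lintegral_mul_norm_pow_le (μ := μ) hH
    (aemeasurable_const (b := (1 : ℝ≥0∞))) h0 (sub_nonneg.2 h1) (by ring)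
  simpa using h

theorem ENNReal.rpow_tsum_le (u : ℕ → ℝ≥0∞) {θ : ℝ} (h0 : 0 < θ) (h1 : θ ≤ 1) :
    (∑' n, u n) ^ θ ≤ ∑' n, u n ^ θ := by
  have hfin (s : Finset ℕ) : (∑ n ∈ s, u n) ^ θ ≤ ∑ n ∈ s, u n ^ θ := by
    induction s using Finset.induction_on with
    | empty => simp [ENNReal.zero_rpow_of_pos h0]
    | insert i s hi ih =>
      rw [Finset.sum_insert hi, Finset.sum_insert hi]
      exact (ENNReal.rpow_add_le_add_rpow _ _ h0.le h1).trans (by gcongr)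
  have ht : Filter.Tendsto (fun s : Finset ℕ => (∑ n ∈ s, u n) ^ θ) Filter.atTop
      (nhds ((∑' n, u n) ^ θ)) :=
    (ENNReal.continuous_rpow_const.tendsto _).comp ENNReal.summable.hasSum
  exact le_of_tendsto' ht fun s => (hfin s).trans (ENNReal.sum_le_tsum s)

/-! ### Localisation at scale δ and passage below L¹. -/

/-- A spread of δ in x and of ±3δ in the curve puts the arguments of F and G in intervals of length
δ + 6δ = 7δ. -/
theorem curveOp_le_of_mem_window {a b : ℝ → ℝ} {A : Set ℝ} (hA : MeasurableSet A) {δ a₀ b₀ : ℝ}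
    (haA : ∀ t ∈ A, |a t - a₀| ≤ 3 * δ) (hbA : ∀ t ∈ A, |b t - b₀| ≤ 3 * δ)
    (F G : ℝ → ℝ≥0∞) {x y : ℝ} (hx : x ∈ Set.Icc (y + 0) (y + 0 + δ)) :
    curveOp a b A F G x ≤ curveOp a b A
      ((Set.Icc (y + (-a₀ - 3 * δ)) (y + (-a₀ - 3 * δ) + 7 * δ)).indicator F)
      ((Set.Icc (y + (-b₀ - 3 * δ)) (y + (-b₀ - 3 * δ) + 7 * δ)).indicator G) x := by
  refine setLIntegral_mono' hA fun t ht => ?_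
  have h1 := abs_le.1 (haA t ht)
  have h2 := abs_le.1 (hbA t ht)
  obtain ⟨h3, h4⟩ := hx
  rw [Set.indicator_of_mem, Set.indicator_of_mem] <;>
    constructor <;> linarith [h1.1, h1.2, h2.1, h2.2]

theorem lintegral_curveOp_rpow_le {a b : ℝ → ℝ} (ha : Measurable a) (hb : Measurable b)
    {A : Set ℝ} (hA : MeasurableSet A) {δ a₀ b₀ : ℝ} (hδ : 0 < δ)
    (haA : ∀ t ∈ A, |a t - a₀| ≤ 3 * δ) (hbA : ∀ t ∈ A, |b t - b₀| ≤ 3 * δ)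
    {K : ℝ≥0∞} (hL : ∀ F G : ℝ → ℝ≥0∞, Measurable F → Measurable G →
      ∫⁻ x, curveOp a b A F G x ≤ K * (ENNReal.ofReal δ)⁻¹ * (∫⁻ x, F x) * ∫⁻ x, G x)
    {R : ℝ} (hR : 1 / 2 ≤ R) (hR1 : R < 1) {F G : ℝ → ℝ≥0∞} (hF : Measurable F)
    (hG : Measurable G) :
    ∫⁻ x, curveOp a b A F G x ^ R ≤ 7 * (K ^ R * 7 ^ (2 * R - 1)) *
      ((∫⁻ x, F x) ^ R * (∫⁻ x, G x ^ (R / (1 - R))) ^ (1 - R)) := by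
  have hR0 : 0 < R := by linarith
  set D := ENNReal.ofReal δ with hD
  have hD0 : D ≠ 0 := by simpa [hD] using hδ
  have hDt : D ≠ ⊤ := ENNReal.ofReal_ne_top
  have h7 : ENNReal.ofReal (7 * δ) = 7 * D := by
    rw [ENNReal.ofReal_mul (by norm_num), hD]; norm_num
  set Q := R / (1 - R) with hQ
  set T := curveOp a b A F G with hT
  have hTm : Measurable T := measurable_curveOp ha hb A hF hG
  set Φ : ℝ → ℝ≥0∞ := fun y =>
    ∫⁻ x in Set.Icc (y + (-a₀ - 3 * δ)) (y + (-a₀ - 3 * δ) + 7 * δ), F x with hΦ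
  set Ψ : ℝ → ℝ≥0∞ := fun y =>
    ∫⁻ x in Set.Icc (y + (-b₀ - 3 * δ)) (y + (-b₀ - 3 * δ) + 7 * δ), G x ^ Q with hΨ
  have hGQ : Measurable fun x => G x ^ Q := by fun_prop
  -- Hölder from L¹ to L^Q on a window; R ≥ 1/2 is what makes Q ≥ 1.
  have hGloc (y : ℝ) :
      ∫⁻ x in Set.Icc (y + (-b₀ - 3 * δ)) (y + (-b₀ - 3 * δ) + 7 * δ), G x ≤
        Ψ y ^ ((1 - R) / R) * (7 * D) ^ ((2 * R - 1) / R) := by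
    have h := lintegral_rpow_le_mul_measure
      (volume.restrict (Set.Icc (y + (-b₀ - 3 * δ)) (y + (-b₀ - 3 * δ) + 7 * δ)))
      hGQ.aemeasurable (θ := (1 - R) / R) (div_nonneg (by linarith) hR0.le)
      ((div_le_one hR0).2 (by linarith))
    have e : Q * ((1 - R) / R) = 1 := by
      rw [hQ]; field_simp [hR0.ne', (by linarith : (1 - R) ≠ 0)]
    have e' : 1 - (1 - R) / R = (2 * R - 1) / R := by field_simp; ring
    simp_rw [← ENNReal.rpow_mul, e, ENNReal.rpow_one] at h
    rw [Measure.restrict_apply MeasurableSet.univ, Set.univ_inter, Real.volume_Icc,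
      add_sub_cancel_left, h7, e'] at h
    exact h
  have hTloc (y : ℝ) : ∫⁻ x in Set.Icc (y + 0) (y + 0 + δ), T x ≤
      K * D⁻¹ * Φ y * (Ψ y ^ ((1 - R) / R) * (7 * D) ^ ((2 * R - 1) / R)) := by
    calc ∫⁻ x in Set.Icc (y + 0) (y + 0 + δ), T x
        ≤ ∫⁻ x in Set.Icc (y + 0) (y + 0 + δ), curveOp a b A
            ((Set.Icc (y + (-a₀ - 3 * δ)) (y + (-a₀ - 3 * δ) + 7 * δ)).indicator F)
            ((Set.Icc (y + (-b₀ - 3 * δ)) (y + (-b₀ - 3 * δ) + 7 * δ)).indicator G) x :=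
          setLIntegral_mono' measurableSet_Icc fun x hx =>
            curveOp_le_of_mem_window hA haA hbA F G hx
      _ ≤ _ := setLIntegral_le_lintegral _ _
      _ ≤ _ := hL _ _ (hF.indicator measurableSet_Icc) (hG.indicator measurableSet_Icc)
      _ ≤ _ := by
          rw [lintegral_indicator measurableSet_Icc, lintegral_indicator measurableSet_Icc]
          exact mul_le_mul_right (hGloc y) _
  have hpt (y : ℝ) : ∫⁻ x in Set.Icc (y + 0) (y + 0 + δ), T x ^ R ≤
      K ^ R * 7 ^ (2 * R - 1) * (Φ y ^ R * Ψ y ^ (1 - R)) := by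
    have h := lintegral_rpow_le_mul_measure (volume.restrict (Set.Icc (y + 0) (y + 0 + δ)))
      hTm.aemeasurable hR0.le hR1.le
    rw [Measure.restrict_apply MeasurableSet.univ, Set.univ_inter, Real.volume_Icc,
      add_sub_cancel_left] at h
    refine h.trans ?_
    refine (mul_le_mul_left (ENNReal.rpow_le_rpow (hTloc y) hR0.le) _).trans (le_of_eq ?_)
    have hR2 : 0 ≤ 2 * R - 1 := by linarith
    simp only [ENNReal.mul_rpow_of_nonneg _ _ hR0.le, ← ENNReal.rpow_mul,
      div_mul_cancel₀ _ hR0.ne', ENNReal.mul_rpow_of_nonneg _ _ hR2, ENNReal.inv_rpow]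
    -- The scale drops out: -R from the L¹ constant, 2R - 1 from Hölder on G, 1 - R from Hölder on
    -- the output.
    have hDD : (D ^ R)⁻¹ * D ^ (2 * R - 1) * D ^ (1 - R) = 1 := by
      rw [← ENNReal.rpow_neg, ← ENNReal.rpow_add _ _ hD0 hDt, ← ENNReal.rpow_add _ _ hD0 hDt]
      ring_nf
      simp
    calc _ = K ^ R * 7 ^ (2 * R - 1) * (Φ y ^ R * Ψ y ^ (1 - R)) *
          ((D ^ R)⁻¹ * D ^ (2 * R - 1) * D ^ (1 - R)) := by ring
      _ = _ := by rw [hDD, mul_one]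
  have hΦm : Measurable Φ := measurable_lintegral_window hF _ _
  have hΨm : Measurable Ψ := measurable_lintegral_window hGQ _ _
  have hmain : D * ∫⁻ x, T x ^ R ≤ D * (7 * (K ^ R * 7 ^ (2 * R - 1)) *
      ((∫⁻ x, F x) ^ R * (∫⁻ x, G x ^ Q) ^ (1 - R))) := by
    calc D * ∫⁻ x, T x ^ R
        = ∫⁻ y, ∫⁻ x in Set.Icc (y + 0) (y + 0 + δ), T x ^ R :=
          (lintegral_window (hTm.pow_const R) 0 δ).symm
      _ ≤ ∫⁻ y, K ^ R * 7 ^ (2 * R - 1) * (Φ y ^ R * Ψ y ^ (1 - R)) := lintegral_mono hpt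
      _ = K ^ R * 7 ^ (2 * R - 1) * ∫⁻ y, Φ y ^ R * Ψ y ^ (1 - R) :=
          lintegral_const_mul _ (by fun_prop)
      -- Hölder over the window positions, with weights R and 1 - R summing to 1.
      _ ≤ K ^ R * 7 ^ (2 * R - 1) * ((∫⁻ y, Φ y) ^ R * (∫⁻ y, Ψ y) ^ (1 - R)) := by
          gcongr
          exact ENNReal.lintegral_mul_norm_pow_le hΦm.aemeasurable hΨm.aemeasurable hR0.le
            (by linarith) (by ring)
      _ = K ^ R * 7 ^ (2 * R - 1) * (((7 * D) * ∫⁻ x, F x) ^ R *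
            ((7 * D) * ∫⁻ x, G x ^ Q) ^ (1 - R)) := by
          rw [lintegral_window hF, lintegral_window hGQ, h7]
      _ = K ^ R * 7 ^ (2 * R - 1) * (((7 * D) ^ R * (7 * D) ^ (1 - R)) * ((∫⁻ x, F x) ^ R *
            (∫⁻ x, G x ^ Q) ^ (1 - R))) := by
          rw [ENNReal.mul_rpow_of_nonneg _ _ hR0.le,
            ENNReal.mul_rpow_of_nonneg _ _ (by linarith : 0 ≤ 1 - R)]
          ring
      _ = _ := by
          rw [← ENNReal.rpow_add _ _ (by simp [hD0]) (ENNReal.mul_ne_top (by simp) hDt)]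
          rw [add_sub_cancel, ENNReal.rpow_one]
          ring
  exact (ENNReal.mul_le_mul_iff_right hD0 hDt).1 hmain

/-! ### L¹ bounds on dyadic shells by change of variables. -/

/-- The dyadic piece `{δ / 2 < |t - 1 / 2| ≤ δ}` around the degenerate point `1 / 2`. -/
def dyadicShell (δ : ℝ) : Set ℝ := {t | δ / 2 < |t - 1 / 2| ∧ |t - 1 / 2| ≤ δ}

theorem measurableSet_dyadicShell (δ : ℝ) : MeasurableSet (dyadicShell δ) := by
  unfold dyadicShell
  measurability

theorem lintegral_comp_parabola_le {δ : ℝ} (hδ : 0 < δ) (G : ℝ → ℝ≥0∞) (u : ℝ) {S : Set ℝ}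
    (hS : MeasurableSet S) (hinj : Set.InjOn (fun t : ℝ => u + t - t ^ 2) S)
    (hlow : ∀ t ∈ S, δ ≤ |1 - 2 * t|) :
    ∫⁻ t in S, G (u + t - t ^ 2) ≤ (ENNReal.ofReal δ)⁻¹ * ∫⁻ x, G x := by
  have hD0 : ENNReal.ofReal δ ≠ 0 := by simpa using hδ
  have hderiv : ∀ t ∈ S, HasDerivWithinAt (fun t : ℝ => u + t - t ^ 2) (1 - 2 * t) S t := by
    intro t _
    exact ((((hasDerivAt_id' t).const_add u).sub (hasDerivAt_pow 2 t)).congr_deriv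
      (by simp)).hasDerivWithinAt
  rw [mul_comm, ← div_eq_mul_inv, ENNReal.le_div_iff_mul_le (Or.inl hD0)
    (Or.inl ENNReal.ofReal_ne_top), mul_comm, ← lintegral_const_mul' _ _ ENNReal.ofReal_ne_top]
  calc ∫⁻ t in S, ENNReal.ofReal δ * G (u + t - t ^ 2)
      ≤ ∫⁻ t in S, ENNReal.ofReal |1 - 2 * t| * G (u + t - t ^ 2) :=
        setLIntegral_mono' hS fun t ht => by gcongr; exact hlow t ht
    _ = ∫⁻ x in (fun t : ℝ => u + t - t ^ 2) '' S, G x :=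
        (lintegral_image_eq_lintegral_abs_deriv_mul hS hderiv hinj G).symm
    _ ≤ _ := setLIntegral_le_lintegral _ _

theorem lintegral_dyadicShell_comp_le {δ : ℝ} (hδ : 0 < δ) (G : ℝ → ℝ≥0∞) (u : ℝ) :
    ∫⁻ t in dyadicShell δ, G (u + t - t ^ 2) ≤ 2 * (ENNReal.ofReal δ)⁻¹ * ∫⁻ x, G x := by
  have hlow : ∀ t ∈ dyadicShell δ, δ ≤ |1 - 2 * t| := by
    intro t ht
    have e : |1 - 2 * t| = 2 * |t - 1 / 2| := by
      rw [← abs_neg, ← abs_two, ← abs_mul, abs_two]; congr 1; ring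
    rw [e]
    linarith [ht.1]
  -- The map is two-to-one, symmetric about 1/2; each half is an injective branch, whence the factor
  -- 2.
  have hsub : dyadicShell δ ⊆ dyadicShell δ ∩ Set.Iic (1 / 2) ∪ dyadicShell δ ∩ Set.Ici (1 / 2) :=
    fun t ht => (le_total t (1 / 2)).imp (fun h => ⟨ht, h⟩) fun h => ⟨ht, h⟩
  have hm := measurableSet_dyadicShell δ
  refine (lintegral_mono_set hsub).trans ((lintegral_union_le _ _ _).trans ?_)
  rw [two_mul, add_mul]
  refine add_le_add
    (lintegral_comp_parabola_le hδ G u (hm.inter measurableSet_Iic) ?_ fun t ht => hlow t ht.1)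
    (lintegral_comp_parabola_le hδ G u (hm.inter measurableSet_Ici) ?_ fun t ht => hlow t ht.1)
  · intro s hs t ht h
    have h1 : (s - t) * (1 - s - t) = 0 := by linear_combination h
    have h2 : s ≤ 1 / 2 := hs.2
    have h3 : t ≤ 1 / 2 := ht.2
    rcases mul_eq_zero.1 h1 with h | h <;> linarith
  · intro s hs t ht h
    have h1 : (s - t) * (1 - s - t) = 0 := by linear_combination h
    have h2 : 1 / 2 ≤ s := hs.2
    have h3 : 1 / 2 ≤ t := ht.2
    rcases mul_eq_zero.1 h1 with h | h <;> linarith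

theorem lintegral_curveOp_parabola_le {δ : ℝ} (hδ : 0 < δ) {F G : ℝ → ℝ≥0∞} (hF : Measurable F)
    (hG : Measurable G) :
    ∫⁻ x, curveOp (fun t => t) (fun t => t ^ 2) (dyadicShell δ) F G x ≤
      2 * (ENNReal.ofReal δ)⁻¹ * (∫⁻ x, F x) * ∫⁻ x, G x := by
  unfold curveOp
  calc ∫⁻ x, ∫⁻ t in dyadicShell δ, F (x - t) * G (x - t ^ 2)
      = ∫⁻ t in dyadicShell δ, ∫⁻ x, F (x - t) * G (x - t ^ 2) :=
        lintegral_lintegral_swap (by unfold Function.uncurry; fun_prop)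
    _ = ∫⁻ t in dyadicShell δ, ∫⁻ u, F u * G (u + t - t ^ 2) := by
        refine lintegral_congr fun t => ?_
        rw [← lintegral_sub_right_eq_self (fun u => F u * G (u + t - t ^ 2)) t]
        simp
    _ = ∫⁻ u, ∫⁻ t in dyadicShell δ, F u * G (u + t - t ^ 2) :=
        lintegral_lintegral_swap (by unfold Function.uncurry; fun_prop)
    _ = ∫⁻ u, F u * ∫⁻ t in dyadicShell δ, G (u + t - t ^ 2) :=
        lintegral_congr fun u => lintegral_const_mul _ (by fun_prop)
    _ ≤ ∫⁻ u, F u * (2 * (ENNReal.ofReal δ)⁻¹ * ∫⁻ x, G x) := by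
        gcongr with u
        exact lintegral_dyadicShell_comp_le hδ G u
    _ = _ := by
        rw [lintegral_mul_const _ hF]
        ring

/-- Uniform localisation and `L¹` bounds on dyadic shells for the operator along `(a, b)`. -/
structure ShellBounds (a b : ℝ → ℝ) : Prop where
  measurable_left : Measurable a
  measurable_right : Measurable b
  left : ∃ a₀, ∀ δ ≤ 2, ∀ t ∈ dyadicShell δ, |a t - a₀| ≤ 3 * δ
  right : ∃ b₀, ∀ δ ≤ 2, ∀ t ∈ dyadicShell δ, |b t - b₀| ≤ 3 * δ
  lintegral_le : ∀ δ > 0, ∀ F G : ℝ → ℝ≥0∞, Measurable F → Measurable G →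
    ∫⁻ x, curveOp a b (dyadicShell δ) F G x ≤
      2 * (ENNReal.ofReal δ)⁻¹ * (∫⁻ x, F x) * ∫⁻ x, G x

theorem ShellBounds.swap {a b : ℝ → ℝ} (h : ShellBounds a b) : ShellBounds b a where
  measurable_left := h.measurable_right
  measurable_right := h.measurable_left
  left := h.right
  right := h.left
  lintegral_le δ hδ F G hF hG := by
    rw [curveOp_swap]
    exact (h.lintegral_le δ hδ G F hG hF).trans (le_of_eq (by ring))

theorem shellBounds_parabola : ShellBounds (fun t => t) (fun t => t ^ 2) where
  measurable_left := by fun_prop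
  measurable_right := by fun_prop
  left := ⟨1 / 2, fun δ _ t ht => by linarith [ht.2, abs_nonneg (t - 1 / 2)]⟩
  right := ⟨1 / 4, fun δ hδ t ht => by
    have e : t ^ 2 - 1 / 4 = (t - 1 / 2) * (t - 1 / 2 + 1) := by ring
    have h0 := abs_nonneg (t - 1 / 2)
    have h1 : |t - 1 / 2 + 1| ≤ 3 := by
      have := abs_le.1 (ht.2.trans hδ)
      exact abs_le.2 ⟨by linarith [this.1], by linarith [this.2]⟩
    rw [e, abs_mul, mul_comm 3]
    exact mul_le_mul ht.2 h1 (abs_nonneg _) (h0.trans ht.2)⟩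
  lintegral_le _ hδ _ _ hF hG := lintegral_curveOp_parabola_le hδ hF hG

/-! ### Summation over shells and finite exponents. -/

/-- The punctured neighbourhood of radius `2` of the degenerate point `1 / 2`. -/
def puncturedBall : Set ℝ := {t | 0 < |t - 1 / 2| ∧ |t - 1 / 2| ≤ 2}

theorem measurableSet_puncturedBall : MeasurableSet puncturedBall := by
  unfold puncturedBall
  measurability

theorem puncturedBall_subset_iUnion :
    puncturedBall ⊆ ⋃ n : ℕ, dyadicShell (2 * (1 / 2) ^ n) := by
  intro t ht
  obtain ⟨n, h1, h2⟩ := exists_nat_pow_near_of_lt_one (x := |t - 1 / 2| / 2) (y := (1 / 2 : ℝ))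
    (by linarith [ht.1]) (by linarith [ht.2]) (by norm_num) (by norm_num)
  rw [pow_succ] at h1
  exact Set.mem_iUnion.2 ⟨n, by linarith, by linarith⟩

theorem tsum_ofReal_dyadic_rpow_lt_top {β : ℝ} (hβ : 0 < β) :
    ∑' n : ℕ, ENNReal.ofReal (2 * (1 / 2) ^ n) ^ β < ⊤ := by
  have e (n : ℕ) : ENNReal.ofReal (2 * (1 / 2) ^ n) ^ β =
      ENNReal.ofReal 2 ^ β * (ENNReal.ofReal (1 / 2) ^ β) ^ n := by
    rw [ENNReal.ofReal_mul (by norm_num), ENNReal.mul_rpow_of_nonneg _ _ hβ.le,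
      ENNReal.ofReal_pow (by norm_num), ← ENNReal.rpow_natCast, ← ENNReal.rpow_natCast,
      ← ENNReal.rpow_mul, ← ENNReal.rpow_mul, mul_comm β]
  simp_rw [e]
  rw [ENNReal.tsum_mul_left, ENNReal.tsum_geometric]
  refine ENNReal.mul_lt_top (ENNReal.rpow_lt_top_of_nonneg hβ.le ENNReal.ofReal_ne_top) ?_
  rw [ENNReal.inv_lt_top, tsub_pos_iff_lt]
  exact ENNReal.rpow_lt_one (by rw [ENNReal.ofReal_lt_one]; norm_num) hβ

theorem lintegral_puncturedBall_rpow_lt_top :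
    ∫⁻ t in puncturedBall, ENNReal.ofReal |t - 1 / 2| ^ (-(1 / 2) : ℝ) < ⊤ := by
  have hshell (δ : ℝ) (hδ : 0 < δ) :
      ∫⁻ t in dyadicShell δ, ENNReal.ofReal |t - 1 / 2| ^ (-(1 / 2) : ℝ) ≤
        ENNReal.ofReal 2 ^ (3 / 2 : ℝ) * ENNReal.ofReal δ ^ (1 / 2 : ℝ) := by
    have hpt : ∀ t ∈ dyadicShell δ, ENNReal.ofReal |t - 1 / 2| ^ (-(1 / 2) : ℝ) ≤
        ENNReal.ofReal (δ / 2) ^ (-(1 / 2) : ℝ) := fun t ht => by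
      rw [ENNReal.rpow_neg, ENNReal.rpow_neg]
      gcongr
      exact ht.1.le
    refine (setLIntegral_mono' (measurableSet_dyadicShell δ) hpt).trans ?_
    have hsub : dyadicShell δ ⊆ Set.Icc (1 / 2 - δ) (1 / 2 + δ) := fun t ht => by
      have := abs_le.1 ht.2
      exact ⟨by linarith [this.1], by linarith [this.2]⟩
    refine (lintegral_mono_set hsub).trans (le_of_eq ?_)
    rw [setLIntegral_const, Real.volume_Icc, ENNReal.ofReal_rpow_of_pos (by positivity),
      ENNReal.ofReal_rpow_of_pos two_pos, ENNReal.ofReal_rpow_of_pos hδ,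
      ← ENNReal.ofReal_mul (by positivity), ← ENNReal.ofReal_mul (by positivity)]
    congr 1
    rw [Real.div_rpow hδ.le two_pos.le, Real.rpow_neg hδ.le, Real.rpow_neg two_pos.le,
      show (3 / 2 : ℝ) = 1 + 1 / 2 by norm_num, Real.rpow_add two_pos, Real.rpow_one]
    have h1 : δ = δ ^ (1 / 2 : ℝ) * δ ^ (1 / 2 : ℝ) := by
      rw [← Real.rpow_add hδ]; norm_num
    have h2 : 0 < δ ^ (1 / 2 : ℝ) := by positivity
    field_simp
    nlinarith [h1]
  refine (lintegral_mono_set puncturedBall_subset_iUnion).trans_lt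
    ((lintegral_iUnion_le _ _).trans_lt ?_)
  refine (ENNReal.tsum_le_tsum fun n => hshell _ (by positivity)).trans_lt ?_
  rw [ENNReal.tsum_mul_left]
  exact ENNReal.mul_lt_top (ENNReal.rpow_lt_top_of_nonneg (by norm_num) ENNReal.ofReal_ne_top)
    (tsum_ofReal_dyadic_rpow_lt_top (by norm_num))

/-- On the shell of radius δ the weight is at most δ^α, so the uniform shell bounds sum as a
geometric series in δ^(αR). -/
theorem ShellBounds.exists_weighted_bound {a b : ℝ → ℝ} (h : ShellBounds a b) {α R : ℝ}
    (hα : 0 < α) (hR : 1 / 2 ≤ R) (hR1 : R < 1) :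
    ∃ C : ℝ≥0∞, C ≠ ⊤ ∧ ∀ F G : ℝ → ℝ≥0∞, Measurable F → Measurable G →
      ∫⁻ x, (∫⁻ t in puncturedBall,
        ENNReal.ofReal |t - 1 / 2| ^ α * (F (x - a t) * G (x - b t))) ^ R ≤
      C * ((∫⁻ x, F x) ^ R * (∫⁻ x, G x ^ (R / (1 - R))) ^ (1 - R)) := by
  have hR0 : 0 < R := by linarith
  obtain ⟨a₀, ha₀⟩ := h.left
  obtain ⟨b₀, hb₀⟩ := h.right
  have ha := h.measurable_left
  have hb := h.measurable_right
  set d : ℕ → ℝ := fun n => 2 * (1 / 2) ^ n with hd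
  have hd0 (n : ℕ) : 0 < d n := by positivity
  have hd2 (n : ℕ) : d n ≤ 2 := by
    have : (1 / 2 : ℝ) ^ n ≤ 1 := pow_le_one₀ (by norm_num) (by norm_num)
    simp only [hd]; linarith
  refine ⟨(∑' n, ENNReal.ofReal (d n) ^ (α * R)) * (7 * (2 ^ R * 7 ^ (2 * R - 1))), ?_, ?_⟩
  · refine ENNReal.mul_ne_top (tsum_ofReal_dyadic_rpow_lt_top (by positivity)).ne ?_
    refine ENNReal.mul_ne_top (by simp) (ENNReal.mul_ne_top ?_ ?_) <;>
      exact ENNReal.rpow_ne_top_of_nonneg (by linarith) (by simp)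
  intro F G hF hG
  have hT (n : ℕ) : Measurable (curveOp a b (dyadicShell (d n)) F G) :=
    measurable_curveOp ha hb _ hF hG
  have hpt (x : ℝ) : (∫⁻ t in puncturedBall,
      ENNReal.ofReal |t - 1 / 2| ^ α * (F (x - a t) * G (x - b t))) ^ R ≤
      ∑' n, ENNReal.ofReal (d n) ^ (α * R) * curveOp a b (dyadicShell (d n)) F G x ^ R := by
    have h1 : ∫⁻ t in puncturedBall,
        ENNReal.ofReal |t - 1 / 2| ^ α * (F (x - a t) * G (x - b t)) ≤
        ∑' n, ENNReal.ofReal (d n) ^ α * curveOp a b (dyadicShell (d n)) F G x := by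
      refine (lintegral_mono_set puncturedBall_subset_iUnion).trans
        ((lintegral_iUnion_le _ _).trans (ENNReal.tsum_le_tsum fun n => ?_))
      rw [curveOp, ← lintegral_const_mul' _ _
        (ENNReal.rpow_ne_top_of_nonneg hα.le ENNReal.ofReal_ne_top)]
      refine setLIntegral_mono' (measurableSet_dyadicShell _) fun t ht => ?_
      gcongr
      exact ht.2
    -- For R < 1 the triangle inequality is replaced by subadditivity of the R-th power.
    refine (ENNReal.rpow_le_rpow h1 hR0.le).trans ((ENNReal.rpow_tsum_le _ hR0 hR1.le).trans ?_)
    refine ENNReal.tsum_le_tsum fun n => ?_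
    rw [ENNReal.mul_rpow_of_nonneg _ _ hR0.le, ENNReal.rpow_mul]
  refine (lintegral_mono hpt).trans ?_
  rw [lintegral_tsum fun n => ((hT n).pow_const R).const_mul _ |>.aemeasurable,
    ← ENNReal.tsum_mul_right, ← ENNReal.tsum_mul_right]
  refine ENNReal.tsum_le_tsum fun n => ?_
  rw [lintegral_const_mul _ ((hT n).pow_const R), mul_assoc]
  gcongr
  exact lintegral_curveOp_rpow_le ha hb (measurableSet_dyadicShell _) (hd0 n)
    (ha₀ _ (hd2 n)) (hb₀ _ (hd2 n)) (h.lintegral_le _ (hd0 n)) hR hR1 hF hG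

/-- Hölder with exponents m and its conjugate; the weight (m - 1)/2 is chosen so that its m-th root
cancels the factor coming from |t - 1/2|^(-1/2). -/
theorem curveOp_rpow_le_weighted {a b : ℝ → ℝ} (ha : Measurable a) (hb : Measurable b) {m : ℝ}
    (hm : 1 < m) {F G : ℝ → ℝ≥0∞} (hF : Measurable F) (hG : Measurable G) (x : ℝ) :
    curveOp a b puncturedBall F G x ≤
      (∫⁻ t in puncturedBall, ENNReal.ofReal |t - 1 / 2| ^ ((m - 1) / 2) *
        (F (x - a t) ^ m * G (x - b t) ^ m)) ^ (1 / m) *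
      (∫⁻ t in puncturedBall, ENNReal.ofReal |t - 1 / 2| ^ (-(1 / 2) : ℝ)) ^ (1 - 1 / m) := by
  have hm0 : 0 < m := by linarith
  have hm1 : 1 / m ≤ 1 := (div_le_one hm0).2 hm.le
  refine le_trans (le_of_eq ?_) (ENNReal.lintegral_mul_norm_pow_le
    (μ := volume.restrict puncturedBall) (p := 1 / m) (q := 1 - 1 / m) (by fun_prop) (by fun_prop)
    (by positivity) (by linarith) (by ring))
  refine setLIntegral_congr_fun measurableSet_puncturedBall fun t ht => ?_
  have h0 : ENNReal.ofReal |t - 1 / 2| ≠ 0 := by simpa using ht.1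
  have e : (m - 1) / 2 * (1 / m) + -(1 / 2) * (1 - 1 / m) = 0 := by field_simp; ring
  have e' : m * (1 / m) = 1 := by field_simp
  simp only [ENNReal.mul_rpow_of_nonneg _ _ (by positivity : 0 ≤ 1 / m), ← ENNReal.rpow_mul, e',
    ENNReal.rpow_one]
  rw [mul_right_comm, ← ENNReal.rpow_add _ _ h0 ENNReal.ofReal_ne_top, e, ENNReal.rpow_zero,
    one_mul]

/-- The shear (t, x) ↦ (t, x - a t) preserves planar measure, so null sets pull back to null sets.
-/
theorem ae_ae_comp_sub {a : ℝ → ℝ} (ha : Measurable a) {P : ℝ → Prop} (h : ∀ᵐ x, P x) :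
    ∀ᵐ x : ℝ, ∀ᵐ t : ℝ, P (x - a t) := by
  have h1 : MeasurePreserving (fun z : ℝ × ℝ => (z.1, z.2 - a z.1))
      (volume.prod volume) (volume.prod volume) :=
    (MeasurePreserving.id volume).skew_product (g := fun t x => x - a t)
      (by unfold Function.uncurry; fun_prop)
      (Filter.Eventually.of_forall fun t => (measurePreserving_sub_right volume (a t)).map_eq)
  have h2 := Measure.quasiMeasurePreserving_snd.comp
    (h1.quasiMeasurePreserving.comp Measure.measurePreserving_swap.quasiMeasurePreserving)
  exact Measure.ae_ae_of_ae_prod (h2.ae h)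

theorem volume_puncturedBall_ne_top : volume puncturedBall ≠ ⊤ := by
  have hsub : puncturedBall ⊆ Set.Icc (-2) 3 := fun t ht => by
    have := abs_le.1 ht.2
    exact ⟨by linarith [this.1], by linarith [this.2]⟩
  exact ((measure_mono hsub).trans_lt measure_Icc_lt_top).ne

theorem ShellBounds.exists_lintegral_bound {a b : ℝ → ℝ} (h : ShellBounds a b) {p q r : ℝ}
    (hp : 1 < p) (hpq : p ≤ q) (hr : r⁻¹ = p⁻¹ + q⁻¹) :
    ∃ C : ℝ≥0∞, C ≠ ⊤ ∧ ∀ F G : ℝ → ℝ≥0∞, Measurable F → Measurable G →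
      (∫⁻ x, curveOp a b puncturedBall F G x ^ r) ^ (1 / r) ≤
        C * (∫⁻ x, F x ^ p) ^ (1 / p) * (∫⁻ x, G x ^ q) ^ (1 / q) := by
  have hp0 : 0 < p := by linarith
  have hq0 : 0 < q := by linarith
  have hr0 : 0 < r := by rw [← inv_pos, hr]; positivity
  have hrq : r = p * q / (p + q) := by rw [← inv_inv r, hr]; field_simp; ring
  -- R = r/p; p ≤ q gives R ≥ 1/2, and R/(1 - R) = q/p is the exponent matching G^p.
  set R := q / (p + q) with hRdef
  have hR : 1 / 2 ≤ R := by rw [hRdef, div_le_div_iff₀ two_pos (by positivity)]; linarith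
  have hR1 : R < 1 := by rw [hRdef, div_lt_one (by positivity)]; linarith
  have e1 : 1 - R = p / (p + q) := by rw [hRdef]; field_simp; ring
  have e2 : p * (R / (1 - R)) = q := by rw [e1, hRdef]; field_simp
  have e3 : 1 / p * r = R := by rw [hrq, hRdef]; field_simp
  have e4 : R * (1 / r) = 1 / p := by rw [hrq, hRdef]; field_simp
  have e5 : (1 - R) * (1 / r) = 1 / q := by rw [hrq, e1]; field_simp
  have hp1 : 1 / p ≤ 1 := (div_le_one hp0).2 hp.le
  obtain ⟨C, hC, hbound⟩ := h.exists_weighted_bound (α := (p - 1) / 2) (by linarith) hR hR1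
  set c : ℝ≥0∞ := (∫⁻ t in puncturedBall,
    ENNReal.ofReal |t - 1 / 2| ^ (-(1 / 2) : ℝ)) ^ (1 - 1 / p) with hc
  have hct : c ≠ ⊤ := ENNReal.rpow_ne_top_of_nonneg (by linarith)
    lintegral_puncturedBall_rpow_lt_top.ne
  refine ⟨(C * c ^ r) ^ (1 / r), ENNReal.rpow_ne_top_of_nonneg (by positivity)
    (ENNReal.mul_ne_top hC (ENNReal.rpow_ne_top_of_nonneg hr0.le hct)), fun F G hF hG => ?_⟩
  have hmain : ∫⁻ x, curveOp a b puncturedBall F G x ^ r ≤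
      C * c ^ r * ((∫⁻ x, F x ^ p) ^ R * (∫⁻ x, G x ^ q) ^ (1 - R)) := by
    have hb1 := hbound _ _ (hF.pow_const p) (hG.pow_const p)
    simp_rw [← ENNReal.rpow_mul, e2] at hb1
    calc ∫⁻ x, curveOp a b puncturedBall F G x ^ r
        ≤ ∫⁻ x, (∫⁻ t in puncturedBall, ENNReal.ofReal |t - 1 / 2| ^ ((p - 1) / 2) *
            (F (x - a t) ^ p * G (x - b t) ^ p)) ^ R * c ^ r := by
          refine lintegral_mono fun x => ?_
          rw [← e3, ENNReal.rpow_mul, ← ENNReal.mul_rpow_of_nonneg _ _ hr0.le]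
          exact ENNReal.rpow_le_rpow
            (curveOp_rpow_le_weighted h.measurable_left h.measurable_right hp hF hG x) hr0.le
      _ = (∫⁻ x, (∫⁻ t in puncturedBall, ENNReal.ofReal |t - 1 / 2| ^ ((p - 1) / 2) *
            (F (x - a t) ^ p * G (x - b t) ^ p)) ^ R) * c ^ r :=
          lintegral_mul_const' _ _ (ENNReal.rpow_ne_top_of_nonneg hr0.le hct)
      _ ≤ _ := mul_le_mul_left hb1 _
      _ = _ := by ring
  have hr1 : 0 ≤ 1 / r := by positivity
  refine (ENNReal.rpow_le_rpow hmain hr1).trans (le_of_eq ?_)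
  rw [ENNReal.mul_rpow_of_nonneg _ _ hr1,
    ENNReal.mul_rpow_of_nonneg ((∫⁻ x, F x ^ p) ^ R) _ hr1,
    ← ENNReal.rpow_mul _ R, ← ENNReal.rpow_mul _ (1 - R), e4, e5, mul_assoc]

/-! ### The endpoint q = ∞. -/

theorem curveOp_le_lintegral_mul_eLpNorm_top {a b : ℝ → ℝ} (hb : Measurable b) (A : Set ℝ)
    {F G : ℝ → ℝ≥0∞} (hF : Measurable F) (ha : Measurable a) :
    ∀ᵐ x, curveOp a b A F G x ≤ eLpNorm G ⊤ volume * ∫⁻ t in A, F (x - a t) := by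
  have hG : ∀ᵐ y, G y ≤ eLpNorm G ⊤ volume := by
    simpa using enorm_ae_le_eLpNormEssSup G volume
  filter_upwards [ae_ae_comp_sub hb hG] with x hx
  rw [← lintegral_const_mul _ (by fun_prop)]
  refine lintegral_mono_ae ((ae_restrict_of_ae hx).mono fun t ht => ?_)
  rw [mul_comm]
  gcongr

theorem exists_eLpNorm_lintegral_comp_sub_le {a : ℝ → ℝ} (ha : Measurable a) {A : Set ℝ}
    (hA : volume A ≠ ⊤) {p : ℝ≥0∞} (hp : 1 < p) :
    ∃ C : ℝ≥0∞, C ≠ ⊤ ∧ ∀ F : ℝ → ℝ≥0∞, Measurable F →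
      eLpNorm (fun x => ∫⁻ t in A, F (x - a t)) p volume ≤ C * eLpNorm F p volume := by
  rcases eq_or_ne p ⊤ with rfl | hpt
  · refine ⟨volume A, hA, fun F hF => ?_⟩
    have hFb : ∀ᵐ y, F y ≤ eLpNorm F ⊤ volume := by
      simpa using enorm_ae_le_eLpNormEssSup F volume
    rw [eLpNorm_exponent_top]
    refine essSup_le_of_ae_le _ ?_
    filter_upwards [ae_ae_comp_sub ha hFb] with x hx
    rw [enorm_eq_self]
    refine (lintegral_mono_ae (ae_restrict_of_ae hx)).trans (le_of_eq ?_)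
    rw [setLIntegral_const, mul_comm]
  · have hp0 : p ≠ 0 := (zero_lt_one.trans hp).ne'
    set s := p.toReal with hs
    have hs1 : 1 < s := by
      rw [hs, ← ENNReal.toReal_one]; exact (ENNReal.toReal_lt_toReal (by simp) hpt).2 hp
    have hs0 : 0 < s := by linarith
    have hs2 : 1 / s ≤ 1 := (div_le_one hs0).2 hs1.le
    refine ⟨(volume A ^ (s - 1) * volume A) ^ (1 / s),
      ENNReal.rpow_ne_top_of_nonneg (by positivity)
        (ENNReal.mul_ne_top (ENNReal.rpow_ne_top_of_nonneg (by linarith) hA) hA), fun F hF => ?_⟩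
    rw [eLpNorm_eq_lintegral_rpow_enorm_toReal hp0 hpt,
      eLpNorm_eq_lintegral_rpow_enorm_toReal hp0 hpt, ← hs,
      ← ENNReal.mul_rpow_of_nonneg _ _ (by positivity)]
    simp only [enorm_eq_self]
    refine ENNReal.rpow_le_rpow ?_ (by positivity)
    have hpt (x : ℝ) : (∫⁻ t in A, F (x - a t)) ^ s ≤
        volume A ^ (s - 1) * ∫⁻ t in A, F (x - a t) ^ s := by
      have h := lintegral_rpow_le_mul_measure (volume.restrict A)
        (H := fun t => F (x - a t) ^ s) (by fun_prop) (θ := 1 / s) (by positivity) hs2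
      simp_rw [← ENNReal.rpow_mul, mul_one_div_cancel hs0.ne', ENNReal.rpow_one] at h
      refine (ENNReal.rpow_le_rpow h hs0.le).trans (le_of_eq ?_)
      rw [ENNReal.mul_rpow_of_nonneg _ _ hs0.le, ← ENNReal.rpow_mul, ← ENNReal.rpow_mul,
        one_div_mul_cancel hs0.ne', ENNReal.rpow_one, Measure.restrict_apply_univ, mul_comm,
        sub_mul, one_div_mul_cancel hs0.ne', one_mul]
    calc ∫⁻ x, (∫⁻ t in A, F (x - a t)) ^ s
        ≤ ∫⁻ x, volume A ^ (s - 1) * ∫⁻ t in A, F (x - a t) ^ s := lintegral_mono hpt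
      _ = volume A ^ (s - 1) * ∫⁻ x, ∫⁻ t in A, F (x - a t) ^ s :=
          lintegral_const_mul' _ _ (ENNReal.rpow_ne_top_of_nonneg (by linarith) hA)
      _ = volume A ^ (s - 1) * ∫⁻ t in A, ∫⁻ x, F (x - a t) ^ s := by
          rw [lintegral_lintegral_swap (by unfold Function.uncurry; fun_prop)]
      _ = _ := by
          simp_rw [lintegral_sub_right_eq_self (fun x => F x ^ s)]
          rw [setLIntegral_const]
          ring

/-! ### Assembly over all exponents and transfer to complex functions. -/

theorem ShellBounds.exists_eLpNorm_bound_of_le {a b : ℝ → ℝ} (h : ShellBounds a b)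
    {p q r : ℝ≥0∞} (hp : 1 < p) (hpq : p ≤ q) (hr : p⁻¹ + q⁻¹ = r⁻¹) :
    ∃ C : ℝ≥0∞, C ≠ ⊤ ∧ ∀ F G : ℝ → ℝ≥0∞, Measurable F → Measurable G →
      eLpNorm (curveOp a b puncturedBall F G) r volume ≤
        C * eLpNorm F p volume * eLpNorm G q volume := by
  rcases eq_or_ne q ⊤ with rfl | hqt
  · obtain rfl : p = r := by simpa using hr
    obtain ⟨C, hC, hb⟩ := exists_eLpNorm_lintegral_comp_sub_le h.measurable_left
      volume_puncturedBall_ne_top hp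
    refine ⟨C, hC, fun F G hF hG => ?_⟩
    have hpt := curveOp_le_lintegral_mul_eLpNorm_top (G := G) h.measurable_right puncturedBall hF
      h.measurable_left
    have hm : Measurable fun x => ∫⁻ t in puncturedBall, F (x - a t) := by
      have ha := h.measurable_left
      have h : Measurable fun z : ℝ × ℝ => F (z.1 - a z.2) := by fun_prop
      exact h.lintegral_prod_right'
    refine (eLpNorm_le_mul_eLpNorm_of_ae_le_mul'' p hm.aestronglyMeasurable
      (by simpa only [enorm_eq_self] using hpt)).trans ?_
    rw [mul_comm]
    exact mul_le_mul_left (hb F hF) _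
  · have hpt : p ≠ ⊤ := ne_top_of_le_ne_top hqt hpq
    have hp0 : p ≠ 0 := (zero_lt_one.trans hp).ne'
    have hq0 : q ≠ 0 := (zero_lt_one.trans_le (hp.le.trans hpq)).ne'
    have hr0 : r ≠ 0 := by
      rintro rfl
      simp [hp0, hq0] at hr
    have hrt : r ≠ ⊤ := by
      rintro rfl
      simp [hpt] at hr
    have hreal : r.toReal⁻¹ = p.toReal⁻¹ + q.toReal⁻¹ := by
      rw [← ENNReal.toReal_inv, ← hr, ENNReal.toReal_add (by simpa) (by simpa),
        ENNReal.toReal_inv, ENNReal.toReal_inv]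
    have hp1 : 1 < p.toReal := by
      rw [← ENNReal.toReal_one]; exact (ENNReal.toReal_lt_toReal (by simp) hpt).2 hp
    obtain ⟨C, hC, hb⟩ := h.exists_lintegral_bound hp1 (ENNReal.toReal_mono hqt hpq) hreal
    refine ⟨C, hC, fun F G hF hG => ?_⟩
    rw [eLpNorm_eq_lintegral_rpow_enorm_toReal hp0 hpt,
      eLpNorm_eq_lintegral_rpow_enorm_toReal hq0 hqt,
      eLpNorm_eq_lintegral_rpow_enorm_toReal hr0 hrt]
    simpa only [enorm_eq_self] using hb F G hF hG

theorem ShellBounds.exists_eLpNorm_bound {a b : ℝ → ℝ} (h : ShellBounds a b)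
    {p q r : ℝ≥0∞} (hp : 1 < p) (hq : 1 < q) (hr : p⁻¹ + q⁻¹ = r⁻¹) :
    ∃ C : ℝ≥0∞, C ≠ ⊤ ∧ ∀ F G : ℝ → ℝ≥0∞, Measurable F → Measurable G →
      eLpNorm (curveOp a b puncturedBall F G) r volume ≤
        C * eLpNorm F p volume * eLpNorm G q volume := by
  rcases le_total p q with hpq | hpq
  · exact h.exists_eLpNorm_bound_of_le hp hpq hr
  · obtain ⟨C, hC, hb⟩ := h.swap.exists_eLpNorm_bound_of_le hq hpq (by rwa [add_comm])
    refine ⟨C, hC, fun F G hF hG => ?_⟩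
    rw [← curveOp_swap, mul_right_comm]
    exact hb G F hG hF

theorem setOf_abs_lt_one_ae_le_puncturedBall :
    {t : ℝ | 1 / 4 < |t| ∧ |t| < 1} ≤ᵐ[volume] puncturedBall := by
  -- Only the null point 1/2 is lost; |t| < 1 gives |t - 1/2| < 3/2.
  filter_upwards [Measure.ae_ne volume (1 / 2 : ℝ)] with t ht hmem
  have := abs_lt.1 hmem.2
  exact ⟨abs_pos.2 (sub_ne_zero.2 ht), abs_le.2 ⟨by linarith [this.1], by linarith [this.2]⟩⟩

theorem parabolaT_ae_eq_curveOp {f g f' g' : ℝ → ℂ} (hf : f =ᵐ[volume] f')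
    (hg : g =ᵐ[volume] g') :
    parabolaT f g =ᵐ[volume] curveOp (fun t => t) (fun t => t ^ 2)
      {t : ℝ | 1 / 4 < |t| ∧ |t| < 1} (fun x => ‖f' x‖ₑ) fun x => ‖g' x‖ₑ := by
  filter_upwards [ae_ae_comp_sub (a := fun t => t) (by fun_prop) hf,
    ae_ae_comp_sub (a := fun t => t ^ 2) (by fun_prop) hg] with x h1 h2
  refine lintegral_congr_ae (ae_restrict_of_ae ?_)
  filter_upwards [h1, h2] with t h3 h4
  rw [h3, h4, enorm_mul]

theorem mainTheorem3 (p q r : ℝ≥0∞) (hp : 1 < p) (hq : 1 < q) (hr : p⁻¹ + q⁻¹ = r⁻¹) :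
    ∃ C : ℝ≥0, ∀ f g : ℝ → ℂ, MemLp f p volume → MemLp g q volume →
      MemLp (parabolaT f g) r volume ∧
        eLpNorm (parabolaT f g) r volume ≤ C * eLpNorm f p volume * eLpNorm g q volume := by
  obtain ⟨C, hC, hb⟩ := shellBounds_parabola.exists_eLpNorm_bound hp hq hr
  refine ⟨C.toNNReal, fun f g hf hg => ?_⟩
  obtain ⟨f', hf'm, hf'⟩ := hf.1
  obtain ⟨g', hg'm, hg'⟩ := hg.1
  have hF := hf'm.measurable.enorm
  have hG := hg'm.measurable.enorm
  have heq := parabolaT_ae_eq_curveOp hf' hg'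
  have hle : eLpNorm (parabolaT f g) r volume ≤
      C.toNNReal * eLpNorm f p volume * eLpNorm g q volume := by
    rw [ENNReal.coe_toNNReal hC, eLpNorm_congr_ae heq, eLpNorm_congr_ae hf',
      eLpNorm_congr_ae hg', ← eLpNorm_enorm f', ← eLpNorm_enorm g']
    refine le_trans (eLpNorm_mono_enorm fun x => ?_) (hb _ _ hF hG)
    exact lintegral_mono_set' setOf_abs_lt_one_ae_le_puncturedBall
  refine ⟨⟨?_, hle.trans_lt ?_⟩, hle⟩
  · exact (measurable_curveOp (by fun_prop) (by fun_prop) _ hF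
      hG).aestronglyMeasurable.congr heq.symm
  · exact ENNReal.mul_lt_top (ENNReal.mul_lt_top ENNReal.coe_lt_top hf.2) hg.2
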